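/- Let $C=\mathbb{R}+e\mathbb{R}$, $e^2=1$, be the algebra of para-complex numbers. Let $M$ be a para-complex manifold of para-complex dimension $n$, that is, a real $2n$-dimensional smooth manifold with an atlas of charts $z^a=x^a+e\,y^a$ ($a=1,\dots,n$) and a field $I$ of endomorphisms of $TM$ such that $I^2=\mathrm{Id}$, $I\neq\pm\mathrm{Id}$, the eigenspaces of $I$ for $1$ and $-1$ have equal dimension at each point, and $dz^a\circ I=e\,dz^a$ for every chart (so that $I\,\partial/\partial x^a=\partial/\partial y^a$, $I\,\partial/\partial y^a=\partial/\partial x^a$). Put $T_CM=TM\otimes_{\mathbb{R}}C$, $T^{1,0}M=\{Z\in T_CM: IZ=eZ\}$, $T^{0,1}M=\{Z\in T_CM: IZ=-eZ\}$, $\widehat X=\frac12(X+e\,IX)\in T^{1,0}M$ for $X\in TM$, $\frac{\partial}{\partial z^a}=\frac12\bigl(\frac{\partial}{\partial x^a}+e\frac{\partial}{\partial y^a}\bigr)$ and $\frac{\partial}{\partial \bar z^a}=\frac12\bigl(\frac{\partial}{\partial x^a}-e\frac{\partial}{\partial y^a}\bigr)$. Let $\widehat g$ be a para-holomorphic Riemannian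 metric on $M$: a smooth, symmetric, non-degenerate $C$-bilinear form on $T_CM$ with $\widehat g(\overline{Z},\overline{W})=\overline{\widehat g(Z,W)}$ and $\widehat g(T^{1,0}M,T^{0,1}M)=0$, whose components $\widehat g_{ab}=\widehat g(\partial/\partial z^a,\partial/\partial z^b)$ satisfy $\partial\widehat g_{ab}/\partial\bar z^c=0$. Let $g(X,Y)=2\,\mathrm{Re}\,\widehat g(\widehat X,\widehat Y)$ for $X,Y\in TM$ be the associated real metric (then $(M,I,g)$ is a para-Kähler Norden manifold). Let $\mathrm{Ric}(g)(X,Y)=\mathrm{Tr}\{Z\mapsto R(Z,X)Y\}$ be the Ricci tensor of the Levi-Civita connection of $g$, and let $\mathrm{Ric}(\widehat g)(Z,W)=\mathrm{Tr}\{V\mapsto\widehat R(V,Z)W\}$ be the Ricci tensor on $T^{1,0}M$ of the Levi-Civita connection of $\widehat g$, which in the coordinates $z^a$ has the Christoffel symbols $\Gamma^c_{ab}=\frac12\sum_d\widehat g^{cd}\bigl(\partial\widehat g_{bd}/\partial z^a+\partial\widehat g_{ad}/\partial z^b-\partial\widehat g_{ab}/\partial z^d\bigr)$. Then $$\mathrm{Ric}(\widehat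 g)(\widehat X,\widehat Y)=\tfrac12\bigl(\mathrm{Ric}(g)(X,Y)+e\,\mathrm{Ric}(g)(X,IY)\bigr)$$ for all tangent vectors $X,Y\in T_xM$, $x\in M$; and, for every real constant $\lambda$, $\widehat g$ is Einstein with constant $\lambda$, i.e. $\mathrm{Ric}(\widehat g)=\lambda\widehat g$ on $T^{1,0}M$, if and only if $g$ is Einstein with the same constant, i.e. $\mathrm{Ric}(g)=\lambda g$. -/

import Mathlib

open scoped Manifold ContDiff TensorProduct

noncomputable section

/-! ### Para-complex numbers and the para-complex coordinate space -/

/-- The algebra of para-complex numbers `C = ℝ + e ℝ`, with `e ^ 2 = 1`. -/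
abbrev ParaComplex : Type := QuadraticAlgebra ℝ 1 0

/-- The para-complex unit `e`. -/
def paraUnit : ParaComplex := ⟨0, 1⟩

/-- The real coordinate space `ℝ²ⁿ` underlying `Cⁿ`: the coordinate `x^a` has index `Sum.inl a`,
the coordinate `y^a` has index `Sum.inr a`, and `z^a = x^a + e y^a`. -/
abbrev ParaModel (n : ℕ) : Type := Fin n ⊕ Fin n → ℝ

/-- Multiplication by `e` on `Cⁿ`, in real coordinates: `(x, y) ↦ (y, x)`. -/
def mulUnit {n : ℕ} (v : ParaModel n) : ParaModel n := fun j => v j.swap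

/-- The real partial derivative `∂f/∂x^j`. -/
def realPartial {ι : Type*} [Fintype ι] [DecidableEq ι] (j : ι) (f : (ι → ℝ) → ℝ) :
    (ι → ℝ) → ℝ :=
  fun y => fderiv ℝ f y (Pi.single j 1)

/-- The partial derivative of a para-complex valued function in a real coordinate direction. -/
def realPartialC {ι : Type*} [Fintype ι] [DecidableEq ι] (j : ι) (f : (ι → ℝ) → ParaComplex) :
    (ι → ℝ) → ParaComplex :=
  fun y => ⟨realPartial j (fun u => (f u).re) y, realPartial j (fun u => (f u).im) y⟩

/-- `∂/∂z^a = (1/2) (∂/∂x^a + e ∂/∂y^a)`. -/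
def paraPartial {n : ℕ} (a : Fin n) (f : ParaModel n → ParaComplex) :
    ParaModel n → ParaComplex :=
  fun y => (1 / 2 : ℝ) •
    (realPartialC (Sum.inl a) f y + paraUnit * realPartialC (Sum.inr a) f y)

/-- `∂/∂z̄^a = (1/2) (∂/∂x^a - e ∂/∂y^a)`. -/
def paraPartialBar {n : ℕ} (a : Fin n) (f : ParaModel n → ParaComplex) :
    ParaModel n → ParaComplex :=
  fun y => (1 / 2 : ℝ) •
    (realPartialC (Sum.inl a) f y - paraUnit * realPartialC (Sum.inr a) f y)

/-! ### Levi-Civita connection, curvature and Ricci tensor in coordinates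

The formulas are written once, for a matrix-valued function `h` with entries in a commutative
real algebra `A` and derivations `D a` along the coordinates. They are used with `A = ℝ` and the
real partial derivatives, and with `A` the para-complex numbers and the derivatives `∂/∂z^a`. -/

section LocalFormulas

variable {E A ι : Type*} [CommRing A] [Algebra ℝ A] [Fintype ι] [DecidableEq ι]

/-- `Γ^c_{ab} = (1/2) h^{cd} (D_a h_{bd} + D_b h_{ad} - D_d h_{ab})`. -/
def christoffel (D : ι → (E → A) → (E → A)) (h : E → Matrix ι ι A) (c a b : ι) : E → A :=
  fun y => (1 / 2 : ℝ) • ∑ d, (h y)⁻¹ c d *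
    (D a (fun u => h u b d) y + D b (fun u => h u a d) y - D d (fun u => h u a b) y)

/-- `R^d_{c,ab}`, the components of `R(X,Y)Z = ∇_X ∇_Y Z - ∇_Y ∇_X Z - ∇_{[X,Y]} Z`, defined by
`R(∂_a, ∂_b) ∂_c = R^d_{c,ab} ∂_d`. -/
def curvatureComp (D : ι → (E → A) → (E → A)) (h : E → Matrix ι ι A) (d c a b : ι) : E → A :=
  fun y => D a (christoffel D h d b c) y - D b (christoffel D h d a c) y
    + ∑ f, (christoffel D h f b c y * christoffel D h d a f y
        - christoffel D h f a c y * christoffel D h d b f y)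

/-- `Ric(∂_a, ∂_b) = Tr (Z ↦ R(Z, ∂_a) ∂_b)`. -/
def ricciComp (D : ι → (E → A) → (E → A)) (h : E → Matrix ι ι A) (a b : ι) : E → A :=
  fun y => ∑ d, curvatureComp D h d b d a y

end LocalFormulas

/-! ### Para-complex manifolds -/

section Manifold

variable {n : ℕ} {M : Type*} [TopologicalSpace M] [ChartedSpace (ParaModel n) M]

variable (n) in
/-- The real tangent space `T_x M`. -/
abbrev ParaTangent (x : M) : Type := TangentSpace (𝓘(ℝ, ParaModel n)) x

variable (n) in
/-- The para-complexified tangent space `T_{C,x} M = C ⊗ T_x M`. -/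
abbrev ParaTangentC (x : M) : Type := ParaComplex ⊗[ℝ] ParaTangent n x

/-- The differential at `x` of a chart `φ`. -/
def chartDiff (φ : OpenPartialHomeomorph M (ParaModel n)) (x : M) :
    ParaTangent n x →ₗ[ℝ] ParaModel n :=
  (mfderiv (𝓘(ℝ, ParaModel n)) (𝓘(ℝ, ParaModel n)) φ x).toLinearMap

/-- The coordinate vector field `∂_j` of a chart `φ`, at the point with coordinates `y`. -/
def coordVector (φ : OpenPartialHomeomorph M (ParaModel n)) (y : ParaModel n)
    (j : Fin n ⊕ Fin n) : ParaTangent n (φ.symm y) :=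
  mfderiv (𝓘(ℝ, ParaModel n)) (𝓘(ℝ, ParaModel n)) φ.symm y
    (Pi.single j 1 : ParaModel n)

/-- `I` is a para-complex structure on `M`: each `(T_x M, I_x)` is a para-complex vector space,
and `I` is the structure induced by the para-holomorphic charts of `M`, in the sense that the
coordinates `z^a = x^a + e y^a` of every chart of `M` satisfy `dz^a ∘ I = e dz^a`. -/
structure IsParaComplexStructure
    (I : ∀ x : M, ParaTangent n x →ₗ[ℝ] ParaTangent n x) : Prop where
  sq_eq_id : ∀ x, I x ∘ₗ I x = LinearMap.id
  ne_id : ∀ x, I x ≠ LinearMap.id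
  ne_neg_id : ∀ x, I x ≠ -LinearMap.id
  finrank_eq : ∀ x, Module.finrank ℝ (LinearMap.ker (LinearMap.id + I x)) =
    Module.finrank ℝ (LinearMap.ker (LinearMap.id - I x))
  chart_paraHolomorphic : ∀ φ ∈ atlas (ParaModel n) M, ∀ x ∈ φ.source, ∀ X : ParaTangent n x,
    chartDiff φ x (I x X) = mulUnit (chartDiff φ x X)

/-- Conjugation on the para-complexified tangent space. -/
def conjC {x : M} : ParaTangentC n x →ₗ[ℝ] ParaTangentC n x :=
  TensorProduct.map
    { toFun := fun z : ParaComplex => star z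
      map_add' := fun z w => star_add z w
      map_smul' := fun r z => by ext <;> simp }
    LinearMap.id

variable (I : ∀ x : M, ParaTangent n x →ₗ[ℝ] ParaTangent n x)

/-- `T^{1,0}_x M = {Z | I Z = e Z}`. -/
def T10 (x : M) : Submodule ParaComplex (ParaTangentC n x) :=
  LinearMap.ker ((I x).baseChange ParaComplex - paraUnit • LinearMap.id)

/-- `T^{0,1}_x M = {Z | I Z = -e Z}`. -/
def T01 (x : M) : Submodule ParaComplex (ParaTangentC n x) :=
  LinearMap.ker ((I x).baseChange ParaComplex + paraUnit • LinearMap.id)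

/-- `X̂ = (1/2) (X + e I X)`. -/
def hat {x : M} (X : ParaTangent n x) : ParaTangentC n x :=
  (1 / 2 : ℝ) • ((1 : ParaComplex) ⊗ₜ[ℝ] X + paraUnit ⊗ₜ[ℝ] I x X)

/-- `∂/∂z^a = (1/2) (∂/∂x^a + e ∂/∂y^a)`, as a para-complex tangent vector. -/
def paraCoordVector (φ : OpenPartialHomeomorph M (ParaModel n)) (y : ParaModel n) (a : Fin n) :
    ParaTangentC n (φ.symm y) :=
  (1 / 2 : ℝ) • ((1 : ParaComplex) ⊗ₜ[ℝ] coordVector φ y (Sum.inl a)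
    + paraUnit ⊗ₜ[ℝ] coordVector φ y (Sum.inr a))

/-- `dz^a = dx^a + e dy^a`, extended to a para-complex linear form on `T_{C,x} M`. -/
def dz (φ : OpenPartialHomeomorph M (ParaModel n)) (x : M) (a : Fin n) :
    ParaTangentC n x →ₗ[ParaComplex] ParaComplex :=
  LinearMap.liftBaseChange ParaComplex
    { toFun := fun X : ParaTangent n x =>
        (⟨chartDiff φ x X (Sum.inl a), chartDiff φ x X (Sum.inr a)⟩ : ParaComplex)
      map_add' := fun X Y => by ext <;> simp
      map_smul' := fun r X => by ext <;> simp }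

/-! ### Para-complex and para-holomorphic Riemannian metrics -/

/-- The components `G_{ab} = G(∂/∂z^a, ∂/∂z^b)` in a chart. -/
def paraComponents (G : ∀ x : M, LinearMap.BilinForm ParaComplex (ParaTangentC n x))
    (φ : OpenPartialHomeomorph M (ParaModel n)) : ParaModel n → Matrix (Fin n) (Fin n) ParaComplex :=
  fun y => Matrix.of fun a b =>
    G (φ.symm y) (paraCoordVector φ y a) (paraCoordVector φ y b)

/-- The components `g_{jk} = g(∂_j, ∂_k)` of a real tensor in a chart. -/
def realComponents (g : ∀ x : M, LinearMap.BilinForm ℝ (ParaTangent n x))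
    (φ : OpenPartialHomeomorph M (ParaModel n)) :
    ParaModel n → Matrix (Fin n ⊕ Fin n) (Fin n ⊕ Fin n) ℝ :=
  fun y => Matrix.of fun j k => g (φ.symm y) (coordVector φ y j) (coordVector φ y k)

/-- `G` is a para-complex Riemannian metric: a smooth symmetric nondegenerate `C`-bilinear
form on `T_C M` with `G(Z̄, W̄)` conjugate to `G(Z, W)` and `G(T^{1,0} M, T^{0,1} M) = 0`. By the
last two conditions smoothness of `G` is smoothness of its components `G_{ab}`. -/
structure IsParaComplexRiemannianMetric
    (G : ∀ x : M, LinearMap.BilinForm ParaComplex (ParaTangentC n x)) : Prop where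
  symm : ∀ x Z W, G x Z W = G x W Z
  nondegenerate : ∀ x, (G x).Nondegenerate
  conj : ∀ x Z W, G x (conjC Z) (conjC W) = star (G x Z W)
  pure : ∀ x, ∀ Z ∈ T10 I x, ∀ W ∈ T01 I x, G x Z W = 0
  smooth : ∀ φ ∈ atlas (ParaModel n) M, ∀ a b,
    ContDiffOn ℝ ∞ (fun y => (paraComponents G φ y a b).re) φ.target ∧
    ContDiffOn ℝ ∞ (fun y => (paraComponents G φ y a b).im) φ.target

/-- A para-holomorphic Riemannian metric is a para-complex Riemannian metric whose components
`G_{ab}` in the charts of `M` are para-holomorphic functions: `∂G_{ab}/∂z̄^c = 0`. -/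
structure IsParaHolomorphicRiemannianMetric
    (G : ∀ x : M, LinearMap.BilinForm ParaComplex (ParaTangentC n x)) : Prop
    extends IsParaComplexRiemannianMetric I G where
  paraHolomorphic : ∀ φ ∈ atlas (ParaModel n) M, ∀ y ∈ φ.target, ∀ a b c,
    paraPartialBar c (fun u => paraComponents G φ u a b) y = 0

/-! ### Ricci tensors and Einstein metrics -/

/-- The Ricci tensor `Ric(g)` at `x`, computed in the chart `φ`. -/
def realRicci (g : ∀ x : M, LinearMap.BilinForm ℝ (ParaTangent n x))
    (φ : OpenPartialHomeomorph M (ParaModel n)) (x : M) (X Y : ParaTangent n x) : ℝ :=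
  ∑ j, ∑ k, ricciComp realPartial (realComponents g φ) j k (φ x) *
    chartDiff φ x X j * chartDiff φ x Y k

/-- The Ricci tensor `Ric(G)` on `T^{1,0} M` of the Levi-Civita connection of a para-holomorphic
Riemannian metric `G`, at `x`, computed in the para-holomorphic coordinates `z^a` of the
chart `φ`. -/
def paraRicci (G : ∀ x : M, LinearMap.BilinForm ParaComplex (ParaTangentC n x))
    (φ : OpenPartialHomeomorph M (ParaModel n)) (x : M) (Z W : ParaTangentC n x) : ParaComplex :=
  ∑ a, ∑ b, ricciComp paraPartial (paraComponents G φ) a b (φ x) * dz φ x a Z * dz φ x b W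

/-- `Ric(g) = lam g`. -/
def IsRealEinstein (g : ∀ x : M, LinearMap.BilinForm ℝ (ParaTangent n x)) (lam : ℝ) : Prop :=
  ∀ φ ∈ atlas (ParaModel n) M, ∀ x ∈ φ.source, ∀ X Y : ParaTangent n x,
    realRicci g φ x X Y = lam * g x X Y

/-- `Ric(G) = lam G` on `T^{1,0} M`, with a real constant `lam`. -/
def IsParaEinstein (G : ∀ x : M, LinearMap.BilinForm ParaComplex (ParaTangentC n x))
    (lam : ℝ) : Prop :=
  ∀ φ ∈ atlas (ParaModel n) M, ∀ x ∈ φ.source, ∀ Z ∈ T10 I x, ∀ W ∈ T10 I x,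
    paraRicci G φ x Z W = lam • G x Z W

end Manifold

end

/-!
Write `ε_A = 1` for a real index `A` standing for `x^a` and `ε_A = e` for one standing for `y^a`,
and `a` for the para-complex index underlying `A`. The whole comparison rests on three facts.

* On a para-holomorphic function the real derivative `∂_A` acts as `ε_A ∂/∂z^a`
  (`ParaHolomorphicOn.realPartialC_eq`).
* A contraction of real parts over a real index is the real part of a contraction over the
  para-complex index: `Σ_D Re(ε_D z_d) Re(ε_D w_d) = Σ_d Re(z_d w_d)` (`sum_re_mul_re`).
* The components of the real metric are `g_{AB} = 2 Re(ε_A ε_B G_{ab})`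
  (`realComponents_eq_realForm`), and those of its inverse are `(1/2) Re(ε_A ε_B G^{ab})`
  (`realForm_inv`).

Hence the Christoffel symbols and the curvature of `g` are the real parts of those of `G`
multiplied by the factors `ε` of their indices (`christoffel_real_eq`, `curvatureComp_real_eq`).
In the trace defining the Ricci tensor the factors of the contracted index cancel as `ε_D ^ 2 = 1`,
and each para-complex index is counted twice, so `Ric(g)_{AB} = 2 Re(ε_A ε_B Ric(G)_{ab})`
(`ricciComp_real_eq`), that is, `Ric(g)(X, Y) = 2 Re Ric(G)(X̂, Ŷ)`. The imaginary part follows on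
replacing `Y` by `I Y`, whose hat is `e Ŷ`. The Einstein conditions correspond because
`G(X̂, Ŷ) = (1/2) (g(X, Y) + e g(X, I Y))` likewise, and `T^{1,0} M` consists of the vectors `X̂`.

For the Christoffel symbols to be para-holomorphic, the inverse matrix of `G_{ab}` must be. The
para-complex numbers are not a field, so this needs `det G_{ab}` to be a unit
(`isUnit_det_paraComponents`), which nondegeneracy of `G` gives through the two homomorphisms
`C → ℝ`.
-/

/-! ### Calculus of para-holomorphic functions -/

section Calculus

lemma paraUnit_mul_self : paraUnit * paraUnit = 1 := by
  ext <;> simp [paraUnit, QuadraticAlgebra.re_one, QuadraticAlgebra.im_one]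

lemma paraUnit_mul_paraUnit_mul (z : ParaComplex) : paraUnit * (paraUnit * z) = z := by
  rw [← mul_assoc, paraUnit_mul_self, one_mul]

lemma re_paraUnit_mul (z : ParaComplex) : (paraUnit * z).re = z.im := by simp [paraUnit]

lemma im_paraUnit_mul (z : ParaComplex) : (paraUnit * z).im = z.re := by simp [paraUnit]

lemma ParaComplex.re_sum {κ : Type*} (s : Finset κ) (f : κ → ParaComplex) :
    (∑ i ∈ s, f i).re = ∑ i ∈ s, (f i).re :=
  map_sum (⟨⟨QuadraticAlgebra.re, rfl⟩, fun _ _ => rfl⟩ : ParaComplex →+ ℝ) f s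

/-- Smoothness on `U` of a para-complex valued function, through its two real components. -/
def ParaSmoothOn {E : Type*} [NormedAddCommGroup E] [NormedSpace ℝ E] (U : Set E)
    (f : E → ParaComplex) : Prop :=
  ContDiffOn ℝ ∞ (fun y => (f y).re) U ∧ ContDiffOn ℝ ∞ (fun y => (f y).im) U

namespace ParaSmoothOn

variable {E : Type*} [NormedAddCommGroup E] [NormedSpace ℝ E] {U : Set E}
  {f g : E → ParaComplex}

lemma const (c : ParaComplex) : ParaSmoothOn U fun _ : E => c :=
  ⟨contDiffOn_const, contDiffOn_const⟩

lemma add (hf : ParaSmoothOn U f) (hg : ParaSmoothOn U g) :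
    ParaSmoothOn U fun y => f y + g y :=
  ⟨hf.1.add hg.1, hf.2.add hg.2⟩

lemma mul (hf : ParaSmoothOn U f) (hg : ParaSmoothOn U g) :
    ParaSmoothOn U fun y => f y * g y := by
  constructor
  · simpa using (hf.1.mul hg.1).add (hf.2.mul hg.2)
  · simpa using (hf.1.mul hg.2).add (hf.2.mul hg.1)

/-- The inverse of a para-complex number `z` is `z̄ / (z z̄)`. -/
lemma inverse (hf : ParaSmoothOn U f) (hu : ∀ y ∈ U, IsUnit (f y)) :
    ParaSmoothOn U fun y => Ring.inverse (f y) := by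
  have hne : ∀ y ∈ U, (f y).re * (f y).re - (f y).im * (f y).im ≠ 0 := fun y hy => by
    have := (QuadraticAlgebra.isUnit_iff_norm_isUnit.1 (hu y hy)).ne_zero
    simpa [QuadraticAlgebra.norm_def] using this
  have hN : ContDiffOn ℝ ∞ (fun y => ((f y).re * (f y).re - (f y).im * (f y).im)⁻¹) U :=
    ((hf.1.mul hf.1).sub (hf.2.mul hf.2)).inv hne
  have hinv : ∀ y ∈ U, Ring.inverse (f y) =
      ((f y).re * (f y).re - (f y).im * (f y).im)⁻¹ • star (f y) := fun y hy => by
    have hn := hne y hy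
    refine (hu y hy).mul_left_cancel ?_
    rw [Ring.mul_inverse_cancel _ (hu y hy)]
    ext
    · simp only [QuadraticAlgebra.re_one, QuadraticAlgebra.re_mul, QuadraticAlgebra.re_smul,
        QuadraticAlgebra.im_smul, QuadraticAlgebra.re_star, QuadraticAlgebra.im_star, smul_eq_mul]
      refine (inv_mul_cancel₀ hn).symm.trans ?_
      ring
    · simp only [QuadraticAlgebra.im_one, QuadraticAlgebra.im_mul, QuadraticAlgebra.re_smul,
        QuadraticAlgebra.im_smul, QuadraticAlgebra.re_star, QuadraticAlgebra.im_star, smul_eq_mul]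
      ring
  constructor
  · refine (hN.mul hf.1).congr fun y hy => ?_
    simp [hinv y hy]
  · refine (hN.mul hf.2.neg).congr fun y hy => ?_
    simp [hinv y hy]

end ParaSmoothOn

variable {ι : Type*} [Fintype ι] [DecidableEq ι] {U : Set (ι → ℝ)}

lemma realPartial_congr (hU : IsOpen U) {f g : (ι → ℝ) → ℝ} (h : ∀ y ∈ U, f y = g y) (j : ι)
    {y : ι → ℝ} (hy : y ∈ U) : realPartial j f y = realPartial j g y := by
  have : f =ᶠ[nhds y] g := Filter.eventually_of_mem (hU.mem_nhds hy) h
  simp only [realPartial, this.fderiv_eq]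

lemma realPartialC_congr (hU : IsOpen U) {f g : (ι → ℝ) → ParaComplex}
    (h : ∀ y ∈ U, f y = g y) (j : ι) {y : ι → ℝ} (hy : y ∈ U) :
    realPartialC j f y = realPartialC j g y := by
  ext
  · exact realPartial_congr hU (fun u hu => by rw [h u hu]) j hy
  · exact realPartial_congr hU (fun u hu => by rw [h u hu]) j hy

lemma realPartial_comm (hU : IsOpen U) {f : (ι → ℝ) → ℝ} (hf : ContDiffOn ℝ ∞ f U) (j k : ι)
    {y : ι → ℝ} (hy : y ∈ U) :
    realPartial j (realPartial k f) y = realPartial k (realPartial j f) y := by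
  have hc : ContDiffAt ℝ ∞ f y := hf.contDiffAt (hU.mem_nhds hy)
  have hd : DifferentiableAt ℝ (fderiv ℝ f) y :=
    (hc.fderiv_right (m := 1) (by norm_cast)).differentiableAt (by simp)
  have hs : IsSymmSndFDerivAt ℝ f y := hc.isSymmSndFDerivAt (by simp; norm_cast)
  have key : ∀ v w : ι → ℝ,
      fderiv ℝ (fun u => fderiv ℝ f u v) y w = fderiv ℝ (fderiv ℝ f) y w v := fun v w => by
    simp [fderiv_clm_apply hd (differentiableAt_const v)]
  change fderiv ℝ (fun u => fderiv ℝ f u _) y _ = fderiv ℝ (fun u => fderiv ℝ f u _) y _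
  rw [key, key, hs.eq]

lemma ContDiffOn.realPartial (hU : IsOpen U) {f : (ι → ℝ) → ℝ} (hf : ContDiffOn ℝ ∞ f U)
    (j : ι) : ContDiffOn ℝ ∞ (realPartial j f) U :=
  (hf.fderiv_of_isOpen hU (by norm_cast)).clm_apply contDiffOn_const

lemma ParaSmoothOn.realPartialC (hU : IsOpen U) {f : (ι → ℝ) → ParaComplex}
    (hf : ParaSmoothOn U f) (j : ι) : ParaSmoothOn U (realPartialC j f) :=
  ⟨hf.1.realPartial hU j, hf.2.realPartial hU j⟩

lemma realPartialC_comm (hU : IsOpen U) {f : (ι → ℝ) → ParaComplex} (hf : ParaSmoothOn U f)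
    (j k : ι) {y : ι → ℝ} (hy : y ∈ U) :
    realPartialC j (realPartialC k f) y = realPartialC k (realPartialC j f) y := by
  ext
  · exact realPartial_comm hU hf.1 j k hy
  · exact realPartial_comm hU hf.2 j k hy

lemma realPartialC_paraUnit_mul (f : (ι → ℝ) → ParaComplex) (j : ι) (y : ι → ℝ) :
    realPartialC j (fun u => paraUnit * f u) y = paraUnit * realPartialC j f y := by
  ext
  · simp only [realPartialC, re_paraUnit_mul]
  · simp only [realPartialC, im_paraUnit_mul]

lemma realPartialC_const (c : ParaComplex) (j : ι) (y : ι → ℝ) :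
    realPartialC j (fun _ => c) y = 0 := by
  ext <;> simp [realPartialC, realPartial]

lemma ParaSmoothOn.differentiableAt {ι : Type*} [Fintype ι] {U : Set (ι → ℝ)} (hU : IsOpen U)
    {f : (ι → ℝ) → ParaComplex} (hf : ParaSmoothOn U f) {y : ι → ℝ} (hy : y ∈ U) :
    DifferentiableAt ℝ (fun u => (f u).re) y ∧
    DifferentiableAt ℝ (fun u => (f u).im) y :=
  ⟨(hf.1.contDiffAt (hU.mem_nhds hy)).differentiableAt (by simp),
    (hf.2.contDiffAt (hU.mem_nhds hy)).differentiableAt (by simp)⟩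

lemma realPartialC_add (hU : IsOpen U) {f g : (ι → ℝ) → ParaComplex} (hf : ParaSmoothOn U f)
    (hg : ParaSmoothOn U g) {y : ι → ℝ} (hy : y ∈ U) (j : ι) :
    realPartialC j (fun u => f u + g u) y = realPartialC j f y + realPartialC j g y := by
  obtain ⟨f1, f2⟩ := hf.differentiableAt hU hy
  obtain ⟨g1, g2⟩ := hg.differentiableAt hU hy
  ext
  · simp [realPartialC, realPartial, fderiv_fun_add f1 g1]
  · simp [realPartialC, realPartial, fderiv_fun_add f2 g2]

lemma realPartialC_mul (hU : IsOpen U) {f g : (ι → ℝ) → ParaComplex} (hf : ParaSmoothOn U f)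
    (hg : ParaSmoothOn U g) {y : ι → ℝ} (hy : y ∈ U) (j : ι) :
    realPartialC j (fun u => f u * g u) y =
      f y * realPartialC j g y + realPartialC j f y * g y := by
  obtain ⟨f1, f2⟩ := hf.differentiableAt hU hy
  obtain ⟨g1, g2⟩ := hg.differentiableAt hU hy
  ext
  · simp [realPartialC, realPartial, fderiv_fun_add (f1.fun_mul g1) (f2.fun_mul g2),
      fderiv_fun_mul f1 g1, fderiv_fun_mul f2 g2]
    ring
  · simp [realPartialC, realPartial, fderiv_fun_add (f1.fun_mul g2) (f2.fun_mul g1),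
      fderiv_fun_mul f1 g2, fderiv_fun_mul f2 g1]
    ring

end Calculus

/-- `f` is smooth and para-holomorphic on `U`: it satisfies the Cauchy-Riemann equations
`∂f/∂y^a = e ∂f/∂x^a`. -/
structure ParaHolomorphicOn {n : ℕ} (U : Set (ParaModel n)) (f : ParaModel n → ParaComplex) :
    Prop where
  smooth : ParaSmoothOn U f
  cauchyRiemann : ∀ y ∈ U, ∀ a,
    realPartialC (Sum.inr a) f y = paraUnit * realPartialC (Sum.inl a) f y

/-- The factor `1` for an index `x^a` and `e` for an index `y^a`: it is the ratio of `∂/∂x^a`,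
respectively `∂/∂y^a`, to `∂/∂z^a` on para-holomorphic functions, and is written `ε_A` below. -/
def unitFactor {n : ℕ} : Fin n ⊕ Fin n → ParaComplex := Sum.elim (fun _ => 1) fun _ => paraUnit

/-- The para-complex index `a` underlying the real index `x^a` or `y^a`. -/
def baseIndex {n : ℕ} : Fin n ⊕ Fin n → Fin n := Sum.elim id id

lemma unitFactor_mul_self {n : ℕ} (A : Fin n ⊕ Fin n) : unitFactor A * unitFactor A = 1 := by
  cases A <;> simp [unitFactor, paraUnit_mul_self]

namespace ParaHolomorphicOn

variable {n : ℕ} {U : Set (ParaModel n)} {f g : ParaModel n → ParaComplex}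

lemma of_paraPartialBar (hf : ParaSmoothOn U f)
    (h : ∀ y ∈ U, ∀ a, paraPartialBar a f y = 0) : ParaHolomorphicOn U f := by
  refine ⟨hf, fun y hy a => ?_⟩
  have h1 := h y hy a
  rw [paraPartialBar, smul_eq_zero_iff_right (by norm_num), sub_eq_zero] at h1
  rw [h1, paraUnit_mul_paraUnit_mul]

lemma congr (hU : IsOpen U) (hf : ParaHolomorphicOn U f) (h : ∀ y ∈ U, g y = f y) :
    ParaHolomorphicOn U g := by
  refine ⟨⟨hf.1.1.congr fun y hy => by rw [h y hy], hf.1.2.congr fun y hy => by rw [h y hy]⟩,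
    fun y hy a => ?_⟩
  rw [realPartialC_congr hU h _ hy, realPartialC_congr hU h _ hy, hf.2 y hy]

lemma const (c : ParaComplex) : ParaHolomorphicOn U fun _ => c :=
  ⟨.const c, fun y _ a => by simp [realPartialC_const]⟩

lemma add (hU : IsOpen U) (hf : ParaHolomorphicOn U f) (hg : ParaHolomorphicOn U g) :
    ParaHolomorphicOn U fun y => f y + g y :=
  ⟨hf.1.add hg.1, fun y hy a => by
    rw [realPartialC_add hU hf.1 hg.1 hy, realPartialC_add hU hf.1 hg.1 hy, hf.2 y hy, hg.2 y hy,
      mul_add]⟩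

lemma mul (hU : IsOpen U) (hf : ParaHolomorphicOn U f) (hg : ParaHolomorphicOn U g) :
    ParaHolomorphicOn U fun y => f y * g y :=
  ⟨hf.1.mul hg.1, fun y hy a => by
    rw [realPartialC_mul hU hf.1 hg.1 hy, realPartialC_mul hU hf.1 hg.1 hy, hf.2 y hy, hg.2 y hy]
    ring⟩

lemma smul (hU : IsOpen U) (r : ℝ) (hf : ParaHolomorphicOn U f) :
    ParaHolomorphicOn U fun y => r • f y :=
  ((const (algebraMap ℝ ParaComplex r)).mul hU hf).congr hU fun _ _ => Algebra.smul_def _ _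

lemma sub (hU : IsOpen U) (hf : ParaHolomorphicOn U f) (hg : ParaHolomorphicOn U g) :
    ParaHolomorphicOn U fun y => f y - g y :=
  (hf.add hU (hg.smul hU (-1))).congr hU fun y _ => by simp [sub_eq_add_neg]

lemma sum (hU : IsOpen U) {κ : Type*} (s : Finset κ) {f : κ → ParaModel n → ParaComplex}
    (hf : ∀ i ∈ s, ParaHolomorphicOn U (f i)) : ParaHolomorphicOn U fun y => ∑ i ∈ s, f i y := by
  classical
  induction s using Finset.induction_on with
  | empty => simpa using const 0
  | insert i s hi ih =>
    simp only [Finset.sum_insert hi]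
    exact (hf i (by simp)).add hU (ih fun k hk => hf k (by simp [hk]))

lemma prod (hU : IsOpen U) {κ : Type*} (s : Finset κ) {f : κ → ParaModel n → ParaComplex}
    (hf : ∀ i ∈ s, ParaHolomorphicOn U (f i)) : ParaHolomorphicOn U fun y => ∏ i ∈ s, f i y := by
  classical
  induction s using Finset.induction_on with
  | empty => simpa using const 1
  | insert i s hi ih =>
    simp only [Finset.prod_insert hi]
    exact (hf i (by simp)).mul hU (ih fun k hk => hf k (by simp [hk]))

lemma inverse (hU : IsOpen U) (hf : ParaHolomorphicOn U f) (hu : ∀ y ∈ U, IsUnit (f y)) :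
    ParaHolomorphicOn U fun y => Ring.inverse (f y) := by
  have hs := hf.1.inverse hu
  refine ⟨hs, fun y hy a => (hu y hy).mul_left_cancel ?_⟩
  -- Differentiate `f * f⁻¹ = 1`.
  have key : ∀ j, f y * realPartialC j (fun u => Ring.inverse (f u)) y =
      -(realPartialC j f y * Ring.inverse (f y)) := fun j => by
    rw [← add_eq_zero_iff_eq_neg, ← realPartialC_mul hU hf.1 hs hy,
      realPartialC_congr hU (fun u hu' => Ring.mul_inverse_cancel _ (hu u hu')) j hy,
      realPartialC_const]
  rw [key, mul_left_comm, key, hf.2 y hy]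
  ring

lemma matrix_det (hU : IsOpen U) {κ : Type*} [Fintype κ] [DecidableEq κ]
    {h : ParaModel n → Matrix κ κ ParaComplex}
    (hh : ∀ a b, ParaHolomorphicOn U fun y => h y a b) :
    ParaHolomorphicOn U fun y => (h y).det := by
  simp only [Matrix.det_apply']
  exact sum hU _ fun σ _ => (const _).mul hU (prod hU _ fun i _ => hh _ _)

/-- By Cramer's rule, the entries of the inverse are polynomials in those of the matrix, divided by
the determinant. -/
lemma matrix_inv (hU : IsOpen U) {κ : Type*} [Fintype κ] [DecidableEq κ]
    {h : ParaModel n → Matrix κ κ ParaComplex}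
    (hh : ∀ a b, ParaHolomorphicOn U fun y => h y a b) (hu : ∀ y ∈ U, IsUnit (h y).det) (a b : κ) :
    ParaHolomorphicOn U fun y => (h y)⁻¹ a b := by
  simp only [Matrix.inv_def, Matrix.smul_apply, Matrix.adjugate_apply, smul_eq_mul]
  refine ((matrix_det hU hh).inverse hU hu).mul hU (matrix_det hU fun i j => ?_)
  simp only [Matrix.updateRow_apply]
  split_ifs
  · exact const _
  · exact hh _ _

/-- `∂/∂x^a` and `∂/∂y^a` act on para-holomorphic functions as `∂/∂z^a` and `e ∂/∂z^a`. -/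
lemma realPartialC_eq (hf : ParaHolomorphicOn U f) {y : ParaModel n} (hy : y ∈ U)
    (A : Fin n ⊕ Fin n) : realPartialC A f y = unitFactor A * paraPartial (baseIndex A) f y := by
  have h : ∀ a, paraPartial a f y = realPartialC (Sum.inl a) f y := fun a => by
    rw [paraPartial, hf.2 y hy, paraUnit_mul_paraUnit_mul, ← two_smul ℝ, smul_smul]
    norm_num
  cases A with
  | inl a => simp [unitFactor, baseIndex, h]
  | inr a => simp [unitFactor, baseIndex, h, hf.2 y hy]

/-- The Cauchy-Riemann equations pass to derivatives because partial derivatives commute. -/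
lemma paraPartial (hU : IsOpen U) (hf : ParaHolomorphicOn U f) (a : Fin n) :
    ParaHolomorphicOn U (paraPartial a f) := by
  have h : ParaHolomorphicOn U (realPartialC (Sum.inl a) f) := by
    refine ⟨hf.1.realPartialC hU _, fun y hy b => ?_⟩
    rw [realPartialC_comm hU hf.1 _ _ hy, realPartialC_congr hU (fun u hu => hf.2 u hu b) _ hy,
      realPartialC_paraUnit_mul, realPartialC_comm hU hf.1 _ _ hy]
  exact h.congr hU fun y hy => by simp [hf.realPartialC_eq hy, unitFactor, baseIndex]

/-- The real partial derivatives of a component of a para-holomorphic function are components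
of its para-complex derivatives. -/
lemma realPartial_re_mul (hU : IsOpen U) (hf : ParaHolomorphicOn U f) (w : ParaComplex)
    (A : Fin n ⊕ Fin n) {y : ParaModel n} (hy : y ∈ U) :
    realPartial A (fun u => (w * f u).re) y =
      (w * (unitFactor A * _root_.paraPartial (baseIndex A) f y)).re := by
  have h := congrArg QuadraticAlgebra.re (realPartialC_mul hU (.const w) hf.1 hy A)
  rw [realPartialC_const, zero_mul, add_zero, hf.realPartialC_eq hy] at h
  exact h

end ParaHolomorphicOn

/-! ### Real and para-complex curvature in coordinates -/

section Local

variable {n : ℕ}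

/-- Contraction over a real index is contraction over the underlying para-complex index. -/
lemma sum_re_mul_re (z w : Fin n → ParaComplex) :
    ∑ D : Fin n ⊕ Fin n, (unitFactor D * z (baseIndex D)).re * (unitFactor D * w (baseIndex D)).re =
      ∑ d, (z d * w d).re := by
  simp only [Fintype.sum_sum_type, unitFactor, baseIndex, Sum.elim_inl, Sum.elim_inr, id, one_mul,
    re_paraUnit_mul, ← Finset.sum_add_distrib]
  simp

/-- The real components `2 Re (ε_A ε_B h_{ab})`, with `ε` the factor `unitFactor`, of the real
metric associated with a para-holomorphic metric with components `h_{ab}`. -/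
def realForm (h : Matrix (Fin n) (Fin n) ParaComplex) :
    Matrix (Fin n ⊕ Fin n) (Fin n ⊕ Fin n) ℝ :=
  Matrix.of fun A B => 2 * (unitFactor A * unitFactor B * h (baseIndex A) (baseIndex B)).re

lemma realForm_inv {h : Matrix (Fin n) (Fin n) ParaComplex} (hu : IsUnit h.det)
    (C D : Fin n ⊕ Fin n) : (realForm h)⁻¹ C D =
      1 / 2 * (unitFactor C * unitFactor D * h⁻¹ (baseIndex C) (baseIndex D)).re := by
  have hinv : (realForm h)⁻¹ = Matrix.of fun C D =>
      1 / 2 * (unitFactor C * unitFactor D * h⁻¹ (baseIndex C) (baseIndex D)).re := by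
    refine Matrix.inv_eq_right_inv ?_
    ext A B
    have h1 : ∑ d, h (baseIndex A) d * h⁻¹ d (baseIndex B) =
        (1 : Matrix (Fin n) (Fin n) ParaComplex) (baseIndex A) (baseIndex B) := by
      rw [← Matrix.mul_nonsing_inv h hu, Matrix.mul_apply]
    have h2 := sum_re_mul_re (fun d => unitFactor A * h (baseIndex A) d)
      (fun d => unitFactor B * h⁻¹ d (baseIndex B))
    calc (realForm h * Matrix.of fun C D : Fin n ⊕ Fin n =>
          1 / 2 * (unitFactor C * unitFactor D * h⁻¹ (baseIndex C) (baseIndex D)).re) A B =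
        ∑ D : Fin n ⊕ Fin n,
          (unitFactor D * (unitFactor A * h (baseIndex A) (baseIndex D))).re *
            (unitFactor D * (unitFactor B * h⁻¹ (baseIndex D) (baseIndex B))).re := by
          rw [Matrix.mul_apply]
          refine Finset.sum_congr rfl fun D _ => ?_
          simp only [realForm, Matrix.of_apply]
          rw [mul_comm (unitFactor A), mul_assoc (unitFactor D), mul_assoc (unitFactor D)]
          ring
      _ = (unitFactor A * unitFactor B * ∑ d, h (baseIndex A) d * h⁻¹ d (baseIndex B)).re := by
          rw [h2, ← ParaComplex.re_sum, Finset.mul_sum]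
          congr 1
          exact Finset.sum_congr rfl fun d _ => by ring
      _ = (1 : Matrix (Fin n ⊕ Fin n) (Fin n ⊕ Fin n) ℝ) A B := by
          rw [h1, Matrix.one_apply, Matrix.one_apply]
          rcases A with a | a <;> rcases B with b | b <;> by_cases hab : a = b <;>
            simp [unitFactor, baseIndex, hab, paraUnit, QuadraticAlgebra.re_one]
  rw [hinv, Matrix.of_apply]

variable {U : Set (ParaModel n)} {h : ParaModel n → Matrix (Fin n) (Fin n) ParaComplex}
  {k : ParaModel n → Matrix (Fin n ⊕ Fin n) (Fin n ⊕ Fin n) ℝ}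

lemma ParaHolomorphicOn.christoffel (hU : IsOpen U)
    (hh : ∀ a b, ParaHolomorphicOn U fun y => h y a b) (hu : ∀ y ∈ U, IsUnit (h y).det)
    (c a b : Fin n) : ParaHolomorphicOn U (christoffel _root_.paraPartial h c a b) :=
  smul hU _ <| sum hU _ fun d _ => (matrix_inv hU hh hu c d).mul hU <|
    (((hh b d).paraPartial hU a).add hU ((hh a d).paraPartial hU b)).sub hU
      ((hh a b).paraPartial hU d)

/-- `Γ^C_{AB} = Re (ε_C ε_A ε_B Γ^c_{ab})`. -/
lemma christoffel_real_eq (hU : IsOpen U)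
    (hh : ∀ a b, ParaHolomorphicOn U fun y => h y a b) (hu : ∀ y ∈ U, IsUnit (h y).det)
    (hk : ∀ y ∈ U, k y = realForm (h y)) (C A B : Fin n ⊕ Fin n) {y : ParaModel n} (hy : y ∈ U) :
    christoffel realPartial k C A B y = (unitFactor C * unitFactor A * unitFactor B *
      christoffel paraPartial h (baseIndex C) (baseIndex A) (baseIndex B) y).re := by
  have hd : ∀ A B D : Fin n ⊕ Fin n, realPartial A (fun u => k u B D) y =
      2 * (unitFactor A * unitFactor B * unitFactor D *
        paraPartial (baseIndex A) (fun u => h u (baseIndex B) (baseIndex D)) y).re := by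
    intro A B D
    have h1 : ∀ u ∈ U, k u B D =
        ((2 : ℝ) • (unitFactor B * unitFactor D) * h u (baseIndex B) (baseIndex D)).re :=
      fun u hu => by rw [hk u hu, realForm, Matrix.of_apply, smul_mul_assoc,
        QuadraticAlgebra.re_smul, smul_eq_mul]
    rw [realPartial_congr hU h1 A hy, (hh _ _).realPartial_re_mul hU _ A hy, smul_mul_assoc,
      QuadraticAlgebra.re_smul, smul_eq_mul]
    congr 2
    ring
  have hs := sum_re_mul_re (fun d => unitFactor C * (h y)⁻¹ (baseIndex C) d) fun d =>
    unitFactor A * unitFactor B *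
      (paraPartial (baseIndex A) (fun u => h u (baseIndex B) d) y +
        paraPartial (baseIndex B) (fun u => h u (baseIndex A) d) y -
        paraPartial d (fun u => h u (baseIndex A) (baseIndex B)) y)
  rw [christoffel, christoffel, mul_smul_comm, QuadraticAlgebra.re_smul]
  congr 1
  rw [Finset.mul_sum, ParaComplex.re_sum]
  refine Eq.trans ?_ (hs.trans ?_)
  · refine Finset.sum_congr rfl fun D _ => ?_
    rw [hk y hy, realForm_inv (hu y hy), hd, hd, hd, mul_comm (1 / 2 : ℝ), mul_assoc]
    congr 1
    · congr 1
      ring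
    · have hred : ∀ p q r : ℝ, 1 / 2 * (2 * p + 2 * q - 2 * r) = p + q - r := fun p q r => by ring
      rw [hred, ← QuadraticAlgebra.re_add, ← QuadraticAlgebra.re_sub]
      congr 1
      ring
  · exact Finset.sum_congr rfl fun d _ => congrArg _ (by ring)

/-- `R^D_{C,AB} = Re (ε_D ε_C ε_A ε_B R^d_{c,ab})`. -/
lemma curvatureComp_real_eq (hU : IsOpen U)
    (hh : ∀ a b, ParaHolomorphicOn U fun y => h y a b) (hu : ∀ y ∈ U, IsUnit (h y).det)
    (hk : ∀ y ∈ U, k y = realForm (h y)) (D C A B : Fin n ⊕ Fin n) {y : ParaModel n}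
    (hy : y ∈ U) :
    curvatureComp realPartial k D C A B y =
      (unitFactor D * unitFactor C * unitFactor A * unitFactor B *
        curvatureComp paraPartial h (baseIndex D) (baseIndex C) (baseIndex A) (baseIndex B) y).re := by
  have hd : ∀ D A B C : Fin n ⊕ Fin n, realPartial A (christoffel realPartial k D B C) y =
      (unitFactor D * unitFactor C * unitFactor A * unitFactor B * paraPartial (baseIndex A)
        (christoffel paraPartial h (baseIndex D) (baseIndex B) (baseIndex C)) y).re := by
    intro D A B C
    rw [realPartial_congr hU (fun u hu' => christoffel_real_eq hU hh hu hk D B C hu') A hy,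
      (ParaHolomorphicOn.christoffel hU hh hu _ _ _).realPartial_re_mul hU _ A hy]
    congr 1
    ring
  have hs : ∀ A B : Fin n ⊕ Fin n, ∑ F, christoffel realPartial k F B C y *
        christoffel realPartial k D A F y =
      (unitFactor D * unitFactor C * unitFactor A * unitFactor B *
        ∑ f, christoffel paraPartial h f (baseIndex B) (baseIndex C) y *
          christoffel paraPartial h (baseIndex D) (baseIndex A) f y).re := by
    intro A B
    rw [Finset.mul_sum, ParaComplex.re_sum]
    refine Eq.trans ?_ ((sum_re_mul_re
      (fun f => unitFactor B * unitFactor C *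
        christoffel paraPartial h f (baseIndex B) (baseIndex C) y)
      (fun f => unitFactor D * unitFactor A *
        christoffel paraPartial h (baseIndex D) (baseIndex A) f y)).trans ?_)
    · refine Finset.sum_congr rfl fun F _ => ?_
      rw [christoffel_real_eq hU hh hu hk _ _ _ hy, christoffel_real_eq hU hh hu hk _ _ _ hy]
      congr 2 <;> ring
    · exact Finset.sum_congr rfl fun f _ => congrArg _ (by ring)
  rw [curvatureComp, curvatureComp, Finset.sum_sub_distrib, Finset.sum_sub_distrib, hd, hd, hs, hs,
    ← QuadraticAlgebra.re_sub, ← QuadraticAlgebra.re_sub, ← QuadraticAlgebra.re_add]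
  congr 1
  ring

/-- `Ric_{AB} = 2 Re (ε_A ε_B Ric_{ab})`. The two values of the real index `D` over a
para-complex index `d` contribute equally to the trace, since `ε_D ^ 2 = 1`; this is
the origin of the factor `2`. -/
lemma ricciComp_real_eq (hU : IsOpen U)
    (hh : ∀ a b, ParaHolomorphicOn U fun y => h y a b) (hu : ∀ y ∈ U, IsUnit (h y).det)
    (hk : ∀ y ∈ U, k y = realForm (h y)) (A B : Fin n ⊕ Fin n) {y : ParaModel n} (hy : y ∈ U) :
    ricciComp realPartial k A B y = 2 * (unitFactor A * unitFactor B *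
      ricciComp paraPartial h (baseIndex A) (baseIndex B) y).re := by
  have hD : ∀ D, curvatureComp realPartial k D B D A y = (unitFactor A * unitFactor B *
      curvatureComp paraPartial h (baseIndex D) (baseIndex B) (baseIndex D) (baseIndex A) y).re := by
    intro D
    rw [curvatureComp_real_eq hU hh hu hk _ _ _ _ hy]
    congr 1
    linear_combination (unitFactor A * unitFactor B * curvatureComp paraPartial h (baseIndex D)
      (baseIndex B) (baseIndex D) (baseIndex A) y) * unitFactor_mul_self D
  simp only [ricciComp, hD, Fintype.sum_sum_type]
  simp only [baseIndex, Sum.elim_inl, Sum.elim_inr, id, ← ParaComplex.re_sum, ← Finset.mul_sum]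
  ring

end Local

/-! ### The type decomposition of the para-complexified tangent space -/

section TypeDecomposition

variable {n : ℕ} {M : Type*} [TopologicalSpace M] [ChartedSpace (ParaModel n) M]
  {I : ∀ x : M, ParaTangent n x →ₗ[ℝ] ParaTangent n x}

variable (I) in
lemma hat_add {x : M} (X Y : ParaTangent n x) : hat I (X + Y) = hat I X + hat I Y := by
  simp only [hat, map_add, TensorProduct.tmul_add, smul_add]
  abel

variable (I) in
lemma hat_smul {x : M} (r : ℝ) (X : ParaTangent n x) : hat I (r • X) = r • hat I X := by
  simp only [hat, map_smul, TensorProduct.tmul_smul, ← smul_add, smul_comm r]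

variable (I) in
lemma hat_sum {x : M} {κ : Type*} (s : Finset κ) (X : κ → ParaTangent n x) :
    hat I (∑ i ∈ s, X i) = ∑ i ∈ s, hat I (X i) :=
  map_sum (⟨⟨hat I, by simp [hat]⟩, hat_add I⟩ : ParaTangent n x →+ ParaTangentC n x) X s

variable (I) in
/-- `Z + e I Z` is twice the `(1,0)`-part of `Z`; it has the form `X̂`. -/
lemma exists_hat_eq_add {x : M} (hI : ∀ x, I x ∘ₗ I x = LinearMap.id) (Z : ParaTangentC n x) :
    ∃ X, Z + paraUnit • (I x).baseChange ParaComplex Z = hat I X := by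
  induction Z using TensorProduct.induction_on with
  | zero => exact ⟨0, by simp [hat]⟩
  | add Z W hZ hW =>
    obtain ⟨X, hX⟩ := hZ
    obtain ⟨Y, hY⟩ := hW
    refine ⟨X + Y, ?_⟩
    rw [hat_add, ← hX, ← hY, map_add, smul_add]
    abel
  | tmul z X =>
    have hII : I x (I x X) = X := LinearMap.congr_fun (hI x) X
    refine ⟨(2 : ℝ) • (z.re • X + z.im • I x X), ?_⟩
    have hz : z = z.re • (1 : ParaComplex) + z.im • paraUnit := by
      ext <;> simp [paraUnit, QuadraticAlgebra.re_one, QuadraticAlgebra.im_one]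
    have hez : paraUnit * z = z.re • paraUnit + z.im • (1 : ParaComplex) := by
      ext <;> simp [paraUnit, QuadraticAlgebra.re_one, QuadraticAlgebra.im_one]
    rw [LinearMap.baseChange_tmul, TensorProduct.smul_tmul', smul_eq_mul, hez, hat]
    nth_rw 1 [hz]
    have hhalf : ∀ r : ℝ, 1 / 2 * (2 * r) = r := fun r => by ring
    simp only [map_smul, map_add, hII, TensorProduct.tmul_smul, TensorProduct.add_tmul,
      TensorProduct.tmul_add, TensorProduct.smul_tmul', smul_smul, smul_add, hhalf]
    abel

lemma hat_apply_eq_smul {x : M} (hI : ∀ x, I x ∘ₗ I x = LinearMap.id) (X : ParaTangent n x) :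
    hat I (I x X) = paraUnit • hat I X := by
  have hII : I x (I x X) = X := LinearMap.congr_fun (hI x) X
  rw [hat, hat, hII, smul_comm]
  congr 1
  rw [smul_add, TensorProduct.smul_tmul', TensorProduct.smul_tmul', smul_eq_mul, smul_eq_mul,
    mul_one, paraUnit_mul_self, add_comm]

lemma mem_T10_iff {x : M} {Z : ParaTangentC n x} :
    Z ∈ T10 I x ↔ (I x).baseChange ParaComplex Z = paraUnit • Z := by
  simp [T10, sub_eq_zero]

lemma hat_mem_T10 {x : M} (hI : ∀ x, I x ∘ₗ I x = LinearMap.id) (X : ParaTangent n x) :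
    hat I X ∈ T10 I x := by
  rw [mem_T10_iff, ← hat_apply_eq_smul hI, hat, hat, LinearMap.map_smul_of_tower, map_add,
    LinearMap.baseChange_tmul, LinearMap.baseChange_tmul]

/-- Every vector of type `(1,0)` is `X̂` for a real vector `X`: `Z = e I Z`, so `Z` is half of
`Z + e I Z`. -/
lemma exists_hat_eq_of_mem_T10 {x : M} (hI : ∀ x, I x ∘ₗ I x = LinearMap.id)
    {Z : ParaTangentC n x} (hZ : Z ∈ T10 I x) : ∃ X, Z = hat I X := by
  obtain ⟨X, hX⟩ := exists_hat_eq_add I hI Z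
  rw [mem_T10_iff.1 hZ, smul_smul, paraUnit_mul_self, one_smul, ← two_smul ℝ] at hX
  refine ⟨(1 / 2 : ℝ) • X, ?_⟩
  rw [hat_smul, ← hX, smul_smul]
  norm_num

/-- By the type decomposition, a nondegenerate form under which `T^{1,0}` and `T^{0,1}` are
orthogonal is nondegenerate on `T^{1,0}`. -/
lemma hat_eq_zero_of_forall {x : M} (hI : ∀ x, I x ∘ₗ I x = LinearMap.id)
    {B : LinearMap.BilinForm ParaComplex (ParaTangentC n x)} (hB : B.Nondegenerate)
    (hpure : ∀ Z ∈ T10 I x, ∀ W ∈ T01 I x, B Z W = 0) {X : ParaTangent n x}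
    (hX : ∀ Y, B (hat I X) (hat I Y) = 0) : hat I X = 0 := by
  refine hB.1 _ fun W => ?_
  obtain ⟨Y, hY⟩ := exists_hat_eq_add I hI W
  have hII : (I x).baseChange ParaComplex ((I x).baseChange ParaComplex W) = W := by
    rw [← LinearMap.comp_apply, ← LinearMap.baseChange_comp, hI, LinearMap.baseChange_id,
      LinearMap.id_apply]
  have h01 : W + (-paraUnit) • (I x).baseChange ParaComplex W ∈ T01 I x := by
    change (I x).baseChange ParaComplex (W + (-paraUnit) • (I x).baseChange ParaComplex W) +
      paraUnit • (W + (-paraUnit) • (I x).baseChange ParaComplex W) = 0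
    rw [map_add, map_smul, hII, smul_add, smul_smul, mul_neg, paraUnit_mul_self, add_add_add_comm,
      add_comm ((-paraUnit) • W), add_add_add_comm, neg_smul, one_smul, ← add_smul,
      add_neg_cancel, add_neg_cancel, zero_smul, add_zero]
  have h2 : (2 : ParaComplex) • W =
      hat I Y + (W + (-paraUnit) • (I x).baseChange ParaComplex W) := by
    rw [← hY, add_add_add_comm, ← add_smul, add_neg_cancel, zero_smul, add_zero, two_smul]
  have h3 : (2 : ParaComplex) * B (hat I X) W = 0 := by
    rw [← smul_eq_mul, ← map_smul, h2, map_add, hX, hpure _ (hat_mem_T10 hI X) _ h01, add_zero]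
  rw [two_mul] at h3
  ext
  · have := congrArg QuadraticAlgebra.re h3
    simp only [QuadraticAlgebra.re_add, QuadraticAlgebra.re_zero] at this ⊢
    linarith
  · have := congrArg QuadraticAlgebra.im h3
    simp only [QuadraticAlgebra.im_add, QuadraticAlgebra.im_zero] at this ⊢
    linarith

end TypeDecomposition

/-! ### Coordinates -/

section Coordinates

variable {n : ℕ} {M : Type*} [TopologicalSpace M] [ChartedSpace (ParaModel n) M]
  {I : ∀ x : M, ParaTangent n x →ₗ[ℝ] ParaTangent n x}

section Chart

variable [IsManifold (𝓘(ℝ, ParaModel n)) ∞ M] {φ : OpenPartialHomeomorph M (ParaModel n)}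

lemma mdifferentiable_of_mem_atlas_paraModel (hφ : φ ∈ atlas (ParaModel n) M) :
    φ.MDifferentiable (𝓘(ℝ, ParaModel n)) (𝓘(ℝ, ParaModel n)) :=
  haveI : IsManifold (𝓘(ℝ, ParaModel n)) 1 M := .of_le (n := ∞) (by norm_cast)
  mdifferentiable_of_mem_atlas hφ

lemma chartDiff_injective (hφ : φ ∈ atlas (ParaModel n) M) {x : M} (hx : x ∈ φ.source) :
    Function.Injective (chartDiff φ x) := fun X Y h => by
  have h1 := (mdifferentiable_of_mem_atlas_paraModel hφ).symm_comp_deriv hx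
  have h2 := congrArg (mfderiv (𝓘(ℝ, ParaModel n)) (𝓘(ℝ, ParaModel n)) φ.symm (φ x)) h
  have hX := DFunLike.congr_fun h1 X
  have hY := DFunLike.congr_fun h1 Y
  exact hX.symm.trans (h2.trans hY)

lemma chartDiff_coordVector (hφ : φ ∈ atlas (ParaModel n) M) {y : ParaModel n}
    (hy : y ∈ φ.target) (j : Fin n ⊕ Fin n) :
    chartDiff φ (φ.symm y) (coordVector φ y j) = Pi.single j 1 :=
  DFunLike.congr_fun ((mdifferentiable_of_mem_atlas_paraModel hφ).comp_symm_deriv hy)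
    (Pi.single j 1 : ParaModel n)

lemma eq_sum_coordVector (hφ : φ ∈ atlas (ParaModel n) M) {y : ParaModel n}
    (hy : y ∈ φ.target) (X : ParaTangent n (φ.symm y)) :
    X = ∑ j, chartDiff φ (φ.symm y) X j • coordVector φ y j := by
  refine chartDiff_injective hφ (φ.map_target hy) ?_
  simp only [map_sum, map_smul, chartDiff_coordVector hφ hy]
  exact pi_eq_sum_univ' _

lemma apply_coordVector_inl (hI : IsParaComplexStructure I) (hφ : φ ∈ atlas (ParaModel n) M)
    {y : ParaModel n} (hy : y ∈ φ.target) (a : Fin n) :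
    I _ (coordVector φ y (Sum.inl a)) = coordVector φ y (Sum.inr a) := by
  refine chartDiff_injective hφ (φ.map_target hy) ?_
  rw [hI.chart_paraHolomorphic φ hφ _ (φ.map_target hy), chartDiff_coordVector hφ hy,
    chartDiff_coordVector hφ hy]
  ext j
  cases j <;> simp [mulUnit, Pi.single_apply]

lemma hat_coordVector (hI : IsParaComplexStructure I) (hφ : φ ∈ atlas (ParaModel n) M)
    {y : ParaModel n} (hy : y ∈ φ.target) (j : Fin n ⊕ Fin n) :
    hat I (coordVector φ y j) = unitFactor j • paraCoordVector φ y (baseIndex j) := by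
  have h : ∀ a, hat I (coordVector φ y (Sum.inl a)) = paraCoordVector φ y a := fun a => by
    rw [hat, paraCoordVector, apply_coordVector_inl hI hφ hy]
  cases j with
  | inl a => simp [unitFactor, baseIndex, h]
  | inr a =>
    rw [← apply_coordVector_inl hI hφ hy, hat_apply_eq_smul hI.sq_eq_id, h]
    simp [unitFactor, baseIndex]

end Chart

lemma dz_hat (hI : IsParaComplexStructure I) {φ : OpenPartialHomeomorph M (ParaModel n)}
    (hφ : φ ∈ atlas (ParaModel n) M) {x : M} (hx : x ∈ φ.source) (a : Fin n)
    (X : ParaTangent n x) : dz φ x a (hat I X) =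
      ⟨chartDiff φ x X (Sum.inl a), chartDiff φ x X (Sum.inr a)⟩ := by
  have h : (1 / 2 : ℝ) • ((1 : ParaComplex) ⊗ₜ[ℝ] X + paraUnit ⊗ₜ[ℝ] I x X) =
      (algebraMap ℝ ParaComplex (1 / 2)) •
        ((1 : ParaComplex) ⊗ₜ[ℝ] X + paraUnit ⊗ₜ[ℝ] I x X) := (algebraMap_smul _ _ _).symm
  rw [hat, h, map_smul, map_add, dz, LinearMap.liftBaseChange_tmul, LinearMap.liftBaseChange_tmul]
  simp only [LinearMap.coe_mk, AddHom.coe_mk, hI.chart_paraHolomorphic φ hφ x hx, mulUnit,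
    Sum.swap_inl, Sum.swap_inr, algebraMap_smul, one_smul]
  ext
  · simp [paraUnit]
    ring
  · simp [paraUnit]
    ring

variable {G : ∀ x : M, LinearMap.BilinForm ParaComplex (ParaTangentC n x)}
  {g : ∀ x : M, LinearMap.BilinForm ℝ (ParaTangent n x)}
  {φ : OpenPartialHomeomorph M (ParaModel n)}

lemma paraHolomorphicOn_paraComponents (hG : IsParaHolomorphicRiemannianMetric I G)
    (hφ : φ ∈ atlas (ParaModel n) M) (a b : Fin n) :
    ParaHolomorphicOn φ.target fun y => paraComponents G φ y a b :=
  .of_paraPartialBar (hG.smooth φ hφ a b) fun y hy c => hG.paraHolomorphic φ hφ y hy a b c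

lemma paraRicci_smul_right (x : M) (Z W : ParaTangentC n x) (c : ParaComplex) :
    paraRicci G φ x Z (c • W) = c * paraRicci G φ x Z W := by
  simp only [paraRicci, map_smul, smul_eq_mul, Finset.mul_sum]
  exact Finset.sum_congr rfl fun a _ => Finset.sum_congr rfl fun b _ => by ring

/-- The ring homomorphism `C → ℝ`, `e ↦ s`, for a square root `s` of `1`. -/
def nullProjection (s : ℝ) (hs : s * s = 1) : ParaComplex →+* ℝ where
  toFun z := z.re + s * z.im
  map_one' := by simp [QuadraticAlgebra.re_one, QuadraticAlgebra.im_one]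
  map_mul' z w := by
    simp
    linear_combination -(z.im * w.im) * hs
  map_zero' := by simp
  map_add' z w := by
    simp
    ring

variable [IsManifold (𝓘(ℝ, ParaModel n)) ∞ M]

lemma realComponents_eq_realForm (hI : IsParaComplexStructure I)
    (hg : ∀ (x : M) (X Y : ParaTangent n x), g x X Y = 2 * (G x (hat I X) (hat I Y)).re)
    (hφ : φ ∈ atlas (ParaModel n) M) {y : ParaModel n} (hy : y ∈ φ.target) :
    realComponents g φ y = realForm (paraComponents G φ y) := by
  ext A B
  simp only [realComponents, realForm, paraComponents, Matrix.of_apply, hg,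
    hat_coordVector hI hφ hy, map_smul, LinearMap.smul_apply, smul_eq_mul]
  congr 2
  ring

/-- A para-complex number is a unit unless one of the two ring homomorphisms `C → ℝ` kills it. If
`e ↦ s` kills `det G_{ab}`, a real null vector `v` of the image of `G_{ab}` gives the vector
`Σ v^a (1 + s e) ∂/∂z^a` in the kernel of `G`. -/
lemma isUnit_det_paraComponents (hI : IsParaComplexStructure I)
    (hG : IsParaHolomorphicRiemannianMetric I G) (hφ : φ ∈ atlas (ParaModel n) M)
    {y : ParaModel n} (hy : y ∈ φ.target) : IsUnit (paraComponents G φ y).det := by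
  set h := paraComponents G φ y with hh
  have key : ∀ (s : ℝ) (hs : s * s = 1), nullProjection s hs h.det ≠ 0 := by
    intro s hs h0
    rw [RingHom.map_det] at h0
    obtain ⟨v, hv0, hv⟩ := Matrix.exists_mulVec_eq_zero_iff.2 h0
    refine hv0 (funext fun a => ?_)
    -- The real vector `X` with `X̂ = Σ v^a (1 + s e) ∂/∂z^a`.
    set X : ParaTangent n (φ.symm y) :=
      ∑ b, v b • (coordVector φ y (Sum.inl b) + s • coordVector φ y (Sum.inr b)) with hX
    have hhat : hat I X = ∑ b, (v b • (⟨1, s⟩ : ParaComplex)) • paraCoordVector φ y b := by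
      rw [hX, hat_sum]
      refine Finset.sum_congr rfl fun b _ => ?_
      rw [hat_smul, hat_add, hat_smul, hat_coordVector hI hφ hy, hat_coordVector hI hφ hy,
        smul_assoc]
      congr 1
      rw [← smul_assoc, baseIndex, Sum.elim_inl, Sum.elim_inr, id, ← add_smul]
      congr 1
      ext <;> simp [unitFactor, paraUnit, QuadraticAlgebra.re_one, QuadraticAlgebra.im_one]
    have hcoord : ∀ a, G (φ.symm y) (paraCoordVector φ y a) (hat I X) = 0 := fun a => by
      have hva : ∑ b, nullProjection s hs (h a b) * v b = 0 := congrFun hv a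
      -- `1 + s e` is an eigenvector of multiplication by any `z`, with eigenvalue the image of `z`.
      have hterm : ∀ b, v b • (⟨1, s⟩ : ParaComplex) * h a b =
          (nullProjection s hs (h a b) * v b) • (⟨1, s⟩ : ParaComplex) := fun b => by
        ext
        · simp [nullProjection]
          ring
        · simp [nullProjection]
          linear_combination -(v b * (h a b).im) * hs
      rw [hhat, map_sum]
      simp only [map_smul, smul_eq_mul]
      calc _ = ∑ b, v b • (⟨1, s⟩ : ParaComplex) * h a b := rfl
        _ = 0 := by rw [Finset.sum_congr rfl fun b _ => hterm b, ← Finset.sum_smul, hva, zero_smul]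
    have hzero : hat I X = 0 := by
      refine hat_eq_zero_of_forall hI.sq_eq_id (hG.nondegenerate _) (hG.pure _) fun Y => ?_
      rw [hG.symm, eq_sum_coordVector hφ hy Y, hat_sum, map_sum, LinearMap.sum_apply]
      refine Finset.sum_eq_zero fun j _ => ?_
      rw [hat_smul, hat_coordVector hI hφ hy, ← algebraMap_smul ParaComplex]
      simp [hcoord]
    have hdz := congrArg QuadraticAlgebra.re (dz_hat hI hφ (φ.map_target hy) a X)
    rw [hzero, map_zero] at hdz
    simpa [hX, chartDiff_coordVector hφ hy, Finset.sum_apply, Pi.single_apply] using hdz.symm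
  rw [QuadraticAlgebra.isUnit_iff_norm_isUnit, isUnit_iff_ne_zero]
  -- The norm `z z̄` is the product of the images of `z` under the two homomorphisms.
  have := mul_ne_zero (key 1 (by norm_num)) (key (-1) (by norm_num))
  refine fun h0 => this ?_
  simp [QuadraticAlgebra.norm_def] at h0
  simp only [nullProjection, RingHom.coe_mk, MonoidHom.coe_mk, OneHom.coe_mk]
  linear_combination h0

end Coordinates

/-! ### Comparison of the Ricci tensors -/

section Ricci

variable {n : ℕ} {M : Type*} [TopologicalSpace M] [ChartedSpace (ParaModel n) M]
    [IsManifold (𝓘(ℝ, ParaModel n)) ∞ M]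
    {I : ∀ x : M, ParaTangent n x →ₗ[ℝ] ParaTangent n x}
    {G : ∀ x : M, LinearMap.BilinForm ParaComplex (ParaTangentC n x)}
    {g : ∀ x : M, LinearMap.BilinForm ℝ (ParaTangent n x)}
    {φ : OpenPartialHomeomorph M (ParaModel n)}

/-- The identity `Ric(g)(X, Y) = 2 Re Ric(G)(X̂, Ŷ)`. As `Ric(G)` is `C`-bilinear and the hat
of `I Y` is `e Ŷ`, it determines the imaginary part of `Ric(G)(X̂, Ŷ)` too. -/
lemma realRicci_eq_two_mul_re (hI : IsParaComplexStructure I)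
    (hG : IsParaHolomorphicRiemannianMetric I G)
    (hg : ∀ (x : M) (X Y : ParaTangent n x), g x X Y = 2 * (G x (hat I X) (hat I Y)).re)
    (hφ : φ ∈ atlas (ParaModel n) M) {x : M} (hx : x ∈ φ.source) (X Y : ParaTangent n x) :
    realRicci g φ x X Y = 2 * (paraRicci G φ x (hat I X) (hat I Y)).re := by
  have hric := fun A B => ricciComp_real_eq φ.open_target
    (paraHolomorphicOn_paraComponents hG hφ)
    (fun y hy => isUnit_det_paraComponents hI hG hφ hy)
    (fun y hy => realComponents_eq_realForm hI hg hφ hy) A B (φ.map_source hx)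
  simp only [realRicci, paraRicci, hric, dz_hat hI hφ hx, ParaComplex.re_sum,
    Fintype.sum_sum_type, unitFactor, baseIndex, Sum.elim_inl, Sum.elim_inr, id,
    ← Finset.sum_add_distrib, Finset.mul_sum, one_mul, mul_one, paraUnit_mul_self,
    re_paraUnit_mul]
  refine Finset.sum_congr rfl fun a _ => Finset.sum_congr rfl fun b _ => ?_
  simp
  ring

end Ricci

theorem mainTheorem1 {n : ℕ} {M : Type*} [TopologicalSpace M] [ChartedSpace (ParaModel n) M]
    [IsManifold (𝓘(ℝ, ParaModel n)) ∞ M]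
    (I : ∀ x : M, ParaTangent n x →ₗ[ℝ] ParaTangent n x)
    (hI : IsParaComplexStructure I)
    (G : ∀ x : M, LinearMap.BilinForm ParaComplex (ParaTangentC n x))
    (hG : IsParaHolomorphicRiemannianMetric I G)
    (g : ∀ x : M, LinearMap.BilinForm ℝ (ParaTangent n x))
    (hg : ∀ (x : M) (X Y : ParaTangent n x), g x X Y = 2 * (G x (hat I X) (hat I Y)).re) :
    (∀ φ ∈ atlas (ParaModel n) M, ∀ x ∈ φ.source, ∀ X Y : ParaTangent n x,
      paraRicci G φ x (hat I X) (hat I Y) =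
        (1 / 2 : ℝ) • (⟨realRicci g φ x X Y, realRicci g φ x X (I x Y)⟩ : ParaComplex)) ∧
    ∀ lam : ℝ, IsParaEinstein I G lam ↔ IsRealEinstein g lam := by
  have hric : ∀ φ ∈ atlas (ParaModel n) M, ∀ x ∈ φ.source, ∀ X Y : ParaTangent n x,
      paraRicci G φ x (hat I X) (hat I Y) =
        (1 / 2 : ℝ) • (⟨realRicci g φ x X Y, realRicci g φ x X (I x Y)⟩ : ParaComplex) := by
    intro φ hφ x hx X Y
    rw [realRicci_eq_two_mul_re hI hG hg hφ hx, realRicci_eq_two_mul_re hI hG hg hφ hx,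
      hat_apply_eq_smul hI.sq_eq_id, paraRicci_smul_right, re_paraUnit_mul]
    ext <;> simp
  refine ⟨hric, fun lam => ⟨fun hE φ hφ x hx X Y => ?_, fun hE φ hφ x hx Z hZ W hW => ?_⟩⟩
  · rw [realRicci_eq_two_mul_re hI hG hg hφ hx, hE φ hφ x hx _ (hat_mem_T10 hI.sq_eq_id X) _
      (hat_mem_T10 hI.sq_eq_id Y), hg, QuadraticAlgebra.re_smul, smul_eq_mul]
    ring
  · obtain ⟨X, rfl⟩ := exists_hat_eq_of_mem_T10 hI.sq_eq_id hZ
    obtain ⟨Y, rfl⟩ := exists_hat_eq_of_mem_T10 hI.sq_eq_id hW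
    rw [hric φ hφ x hx, hE φ hφ x hx, hE φ hφ x hx, hg, hg, hat_apply_eq_smul hI.sq_eq_id,
      map_smul, smul_eq_mul, re_paraUnit_mul]
    ext
    · simp
      ring
    · simp
      ring
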